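/- Let $A\in\mathbb{R}^{n\times n}$ and $C_i\in\mathbb{R}^{r_i\times n}$, $i\in\mathcal V=\{1,\dots,N\}$, and consider $x[k+1]=Ax[k]$, $y_i[k]=C_ix[k]$, $k\in\mathbb{N}=\{0,1,2,\dots\}$. Let $C$ be the matrix obtained by stacking $C_1,\dots,C_N$, and suppose that $(A,C)$ is observable. Then there is an invertible matrix $\mathbf{T}$ such that, in a suitable partition of the coordinates into $N$ (possibly empty) blocks, $\bar A=\mathbf T^{-1}A\mathbf T=(A_{jq})$ and $\bar C_j=C_j\mathbf T=(C_{j1},\dots,C_{jN})$ satisfy $A_{jq}=0$ and $C_{jq}=0$ for $q>j$, and every pair $(A_{jj},C_{jj})$ is observable. Moreover, for every such $\mathbf T$ and every $\rho\in(0,1)$ there are gains $L_1,\dots,L_N$ for which the following holds. Let $\mathcal G[k]=(\mathcal V,\mathcal E[k])$, $k\in\mathbb{N}$, be any sequence of directed graphs which is jointly strongly connected: for some integer $T\ge1$ the union graph over each interval $[kT,(k+1)T)$, $k\in\mathbb N$, is strongly connected. Let $\mathcal N_i[k]=\{l\neq i:(l,i)\in\mathcal E[k]\}$. Write $z[k]=\mathbf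 T^{-1}x[k]$, with substates $z^{(1)}[k],\dots,z^{(N)}[k]$ according to the partition. Let each node $i$ maintain an estimate $\hat z_i[k]$ of $z[k]$ (with arbitrary $\hat z_i[0]$) and freshness-indices $\tau_i^{(j)}[k]\in\mathbb{N}\cup\{\omega\}$, updated by the following rules for every $j$. (Source node.) $\tau^{(j)}_j[k]=0$ for all $k$, and $$\hat z_j^{(j)}[k+1]=(A_{jj}-L_jC_{jj})\hat z_j^{(j)}[k]+\sum_{q<j}(A_{jq}-L_jC_{jq})\hat z_j^{(q)}[k]+L_jy_j[k].$$ (Nodes $i\ne j$.) $\tau_i^{(j)}[0]=\omega$. Let $\mathcal M=\{l\in\mathcal N_i[k]:\tau_l^{(j)}[k]\ne\omega\}$. Put $\mathcal S=\mathcal M$ if $\tau_i^{(j)}[k]=\omega$, and $\mathcal S=\{l\in\mathcal M:\tau_l^{(j)}[k]<\tau_i^{(j)}[k]\}$ otherwise. If $\mathcal S\neq\emptyset$, let $u$ be a node of $\mathcal S$ with the least $\tau_u^{(j)}[k]$ (ties are broken arbitrarily) and set $\tau_i^{(j)}[k+1]=\tau_u^{(j)}[k]+1$; if $\mathcal S=\emptyset$,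 let $u=i$ and set $\tau_i^{(j)}[k+1]=\tau_i^{(j)}[k]+1$, where $\omega+1=\omega$. In either case $$\hat z_i^{(j)}[k+1]=A_{jj}\hat z_u^{(j)}[k]+\sum_{q<j}A_{jq}\hat z_i^{(q)}[k].$$ Then, for every trajectory $x[\cdot]$ of the system and every execution of these rules, the estimation error of every node converges to zero exponentially at rate $\rho$: there is a constant $c$, which may depend on the execution, such that $\|\hat z_i[k]-z[k]\|\le c\rho^k$ and $\|\mathbf T\hat z_i[k]-x[k]\|\le c\rho^k$ for all $i\in\mathcal V$ and $k\in\mathbb{N}$, with the Euclidean norm. -/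

import Mathlib

open scoped Matrix

noncomputable section

namespace DistObs

/-! ### Linear systems -/

/-- Observability of the pair `(A, C)`: the output sequence `C A^k x`, `k ∈ ℕ`, of the system
`x[k+1] = A x[k]`, `y[k] = C x[k]` determines the initial state. -/
def Observable {ι κ : Type*} [Fintype ι] [DecidableEq ι]
    (A : Matrix ι ι ℝ) (C : Matrix κ ι ℝ) : Prop :=
  ∀ x x' : ι → ℝ, (∀ k : ℕ, C *ᵥ (A ^ k *ᵥ x) = C *ᵥ (A ^ k *ᵥ x')) → x = x'

/-- The collective observation matrix, obtained by stacking `C_1, …, C_N`. -/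
def stack {N n : ℕ} {r : Fin N → ℕ} (C : (i : Fin N) → Matrix (Fin (r i)) (Fin n) ℝ) :
    Matrix (Σ i, Fin (r i)) (Fin n) ℝ :=
  Matrix.of fun p s => C p.1 p.2 s

/-- The Euclidean norm of a real vector. -/
def enorm2 {ι : Type*} [Fintype ι] (v : ι → ℝ) : ℝ := ‖WithLp.toLp 2 v‖

/-! ### The coordinate change `x = T z` -/

/-- The block `(j, q)` of a square matrix whose index set is partitioned into `N` blocks. -/
def sqBlock {N : ℕ} {d : Fin N → ℕ} (M : Matrix (Σ j, Fin (d j)) (Σ j, Fin (d j)) ℝ)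
    (j q : Fin N) : Matrix (Fin (d j)) (Fin (d q)) ℝ :=
  Matrix.of fun a b => M ⟨j, a⟩ ⟨q, b⟩

/-- The `q`-th column block of a matrix whose columns are partitioned into `N` blocks. -/
def colBlock {N m : ℕ} {d : Fin N → ℕ} (M : Matrix (Fin m) (Σ j, Fin (d j)) ℝ)
    (q : Fin N) : Matrix (Fin m) (Fin (d q)) ℝ :=
  Matrix.of fun a b => M a ⟨q, b⟩

/-- The `j`-th substate `z^{(j)}` of a vector `z`. -/
def substate {N : ℕ} {d : Fin N → ℕ} (z : (Σ j, Fin (d j)) → ℝ) (j : Fin N) : Fin (d j) → ℝ :=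
  fun a => z ⟨j, a⟩

/-- A similarity transformation bringing `A` and `C_1, …, C_N` simultaneously to the block lower
triangular multi-sensor observable form: with `Abar = T⁻¹ A T` and `Cbar_i = C_i T`, partitioned
into blocks of sizes `dim 1, …, dim N` (a size may be zero), one has `A_{jq} = 0` and
`C_{jq} = 0` for `q > j`, and every pair `(A_{jj}, C_{jj})` is observable. -/
structure ObsForm {N n : ℕ} {r : Fin N → ℕ} (A : Matrix (Fin n) (Fin n) ℝ)
    (C : (i : Fin N) → Matrix (Fin (r i)) (Fin n) ℝ) where
  /-- the dimensions of the substates -/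
  dim : Fin N → ℕ
  /-- the transformation matrix -/
  T : Matrix (Fin n) (Σ j, Fin (dim j)) ℝ
  /-- its inverse -/
  Tinv : Matrix (Σ j, Fin (dim j)) (Fin n) ℝ
  T_mul_Tinv : T * Tinv = 1
  Tinv_mul_T : Tinv * T = 1
  A_upper : ∀ j q : Fin N, j < q → sqBlock (Tinv * A * T) j q = 0
  C_upper : ∀ j q : Fin N, j < q → colBlock (C j * T) q = 0
  diag_observable : ∀ j : Fin N,
    Observable (sqBlock (Tinv * A * T) j j) (colBlock (C j * T) j)

section Form

variable {N n : ℕ} {r : Fin N → ℕ} {A : Matrix (Fin n) (Fin n) ℝ}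
  {C : (i : Fin N) → Matrix (Fin (r i)) (Fin n) ℝ}

/-- The block `A_{jq}` of `T⁻¹ A T`. -/
def ObsForm.Ab (D : ObsForm A C) (j q : Fin N) : Matrix (Fin (D.dim j)) (Fin (D.dim q)) ℝ :=
  sqBlock (D.Tinv * A * D.T) j q

/-- The block `C_{jq}` of `C_j T`. -/
def ObsForm.Cb (D : ObsForm A C) (j q : Fin N) : Matrix (Fin (r j)) (Fin (D.dim q)) ℝ :=
  colBlock (C j * D.T) q

end Form

/-! ### Time-varying directed graphs -/

/-- The union graph over the time interval `[k₁, k₂)`. -/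
def unionGraph {V : Type*} (G : ℕ → Digraph V) (k₁ k₂ : ℕ) : Digraph V where
  Adj u v := ∃ t, k₁ ≤ t ∧ t < k₂ ∧ (G t).Adj u v

/-- A directed graph is strongly connected if there is a directed path from every node to
every node. -/
def StronglyConnected {V : Type*} (G : Digraph V) : Prop :=
  ∀ u v, Relation.ReflTransGen G.Adj u v

/-- Joint strong connectivity: for some `T ≥ 1`, the union graph over every interval
`[kT, (k+1)T)` is strongly connected. -/
def JointlyStronglyConnected {V : Type*} (G : ℕ → Digraph V) : Prop :=
  ∃ T : ℕ, 0 < T ∧ ∀ k : ℕ, StronglyConnected (unionGraph G (k * T) ((k + 1) * T))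

/-! ### The distributed observer

`τ k i j` is the freshness-index of node `i` for substate `j` at time `k`, the value `⊤` playing
the role of the dummy value `ω`; `zh k i` is the estimate of `z[k]` maintained by node `i`. -/

/-- The neighbors of node `i` other than `i` whose freshness-index is not `ω`. -/
def setM {N : ℕ} (G : Digraph (Fin N)) (τ : Fin N → Fin N → ℕ∞) (i j : Fin N) : Set (Fin N) :=
  {l | l ≠ i ∧ G.Adj l i ∧ τ l j ≠ ⊤}

/-- Those among them whose freshness-index is strictly smaller than that of node `i`. -/
def setF {N : ℕ} (G : Digraph (Fin N)) (τ : Fin N → Fin N → ℕ∞) (i j : Fin N) : Set (Fin N) :=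
  {l | l ∈ setM G τ i j ∧ τ l j < τ i j}

/-- `u` is one of the nodes of `S` with the least freshness-index for substate `j`. -/
def IsFreshest {N : ℕ} (τ : Fin N → Fin N → ℕ∞) (j : Fin N) (S : Set (Fin N))
    (u : Fin N) : Prop :=
  u ∈ S ∧ ∀ l ∈ S, τ u j ≤ τ l j

section Observer

variable {N n : ℕ} {r : Fin N → ℕ} {A : Matrix (Fin n) (Fin n) ℝ}
  {C : (i : Fin N) → Matrix (Fin (r i)) (Fin n) ℝ}

/-- The right-hand side of the estimate update of the source node `j` for substate `j`, with
output-injection gain `L_j`, current estimate `z` and current measurement `y`. -/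
def sourceUpdate (D : ObsForm A C) (L : (j : Fin N) → Matrix (Fin (D.dim j)) (Fin (r j)) ℝ)
    (j : Fin N) (z : (Σ q, Fin (D.dim q)) → ℝ) (y : Fin (r j) → ℝ) : Fin (D.dim j) → ℝ :=
  (D.Ab j j - L j * D.Cb j j) *ᵥ substate z j
    + ∑ q ∈ Finset.Iio j, (D.Ab j q - L j * D.Cb j q) *ᵥ substate z q
    + L j *ᵥ y

/-- The right-hand side of the estimate update of a non-source node for substate `j`, where `z`
is its own current estimate and `w` is the current estimate of the node it listens to (`w = z`
when it runs open-loop). -/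
def relayUpdate (D : ObsForm A C) (j : Fin N) (w z : (Σ q, Fin (D.dim q)) → ℝ) :
    Fin (D.dim j) → ℝ :=
  D.Ab j j *ᵥ substate w j + ∑ q ∈ Finset.Iio j, D.Ab j q *ᵥ substate z q

/-- `(τ, zh)` is an execution of the freshness-index based distributed observer with gains `L`
over the graphs `G` and the measurements `y`. Initial estimates are arbitrary, and so is the way
in which ties between freshest neighbors are broken. -/
structure IsExecution (D : ObsForm A C)
    (L : (j : Fin N) → Matrix (Fin (D.dim j)) (Fin (r j)) ℝ)
    (G : ℕ → Digraph (Fin N)) (y : ℕ → (i : Fin N) → Fin (r i) → ℝ)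
    (τ : ℕ → Fin N → Fin N → ℕ∞)
    (zh : ℕ → Fin N → (Σ q, Fin (D.dim q)) → ℝ) : Prop where
  /-- The source node keeps its freshness-index at zero. -/
  source_index : ∀ k j, τ k j j = 0
  /-- The source node uses its own measurements. -/
  source_estimate : ∀ k j,
    substate (zh (k + 1) j) j = sourceUpdate D L j (zh k j) (y k j)
  /-- The other nodes start with infinite delay. -/
  init_index : ∀ i j, i ≠ j → τ 0 i j = ⊤
  /-- Untriggered index, some neighbor with finite delay. -/
  case1_listen : ∀ k i j, i ≠ j → τ k i j = ⊤ → (setM (G k) (τ k) i j).Nonempty →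
    ∃ u, IsFreshest (τ k) j (setM (G k) (τ k) i j) u ∧
      τ (k + 1) i j = τ k u j + 1 ∧
      substate (zh (k + 1) i) j = relayUpdate D j (zh k u) (zh k i)
  /-- Untriggered index, no neighbor with finite delay. -/
  case1_open : ∀ k i j, i ≠ j → τ k i j = ⊤ → setM (G k) (τ k) i j = ∅ →
    τ (k + 1) i j = ⊤ ∧
      substate (zh (k + 1) i) j = relayUpdate D j (zh k i) (zh k i)
  /-- Triggered index, some strictly fresher neighbor. -/
  case2_listen : ∀ k i j, i ≠ j → τ k i j ≠ ⊤ → (setF (G k) (τ k) i j).Nonempty →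
    ∃ u, IsFreshest (τ k) j (setF (G k) (τ k) i j) u ∧
      τ (k + 1) i j = τ k u j + 1 ∧
      substate (zh (k + 1) i) j = relayUpdate D j (zh k u) (zh k i)
  /-- Triggered index, no strictly fresher neighbor. -/
  case2_open : ∀ k i j, i ≠ j → τ k i j ≠ ⊤ → setF (G k) (τ k) i j = ∅ →
    τ (k + 1) i j = τ k i j + 1 ∧
      substate (zh (k + 1) i) j = relayUpdate D j (zh k i) (zh k i)

end Observer

end DistObs

end

/-! The gains can be taken deadbeat, so the estimation error of each execution is zero after
finitely many steps. An error that is eventually zero is bounded by `c * ρ ^ k` for every `ρ > 0`,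
with `c` depending on the execution.

Deadbeat gains: let `S 0` be the whole space and `S (k+1) = A (S k ⊓ ker C)`. Observability forces
`S m = 0` for some `m`. A map `F` that agrees with `A` on `ker C` has the form `A - L C`, and
`exists_shift_silentImage` builds one with `F (S i) ≤ S (i+1)` for all `i`, so `F ^ m = 0`.

Convergence is by strong induction on the substate `j`. Once the lower substates are exact
everywhere, the source error obeys a nilpotent recursion and dies out. A relayed estimate carries
the time `k - τ` at which it left the source; copying preserves that time, and each connected window
brings recent information to a further node. Eventually every node holds only data that left the
source after it became exact, and relaying by the exact model keeps it exact.

The observable form comes from the `A`-invariant chain of states invisible to the first `m` sensors: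
in a basis adapted to it, block `j` is what sensor `j` sees beyond its predecessors. -/

noncomputable section

namespace DistObs

/-! ### Deadbeat output injection -/

section Deadbeat

variable {K V Y : Type*} [Field K] [AddCommGroup V] [Module K V] [AddCommGroup Y] [Module K Y]

/-- There is a linear map fixing a subspace `P` pointwise and sending `U` into `U ⊓ P`. -/
theorem exists_linearMap_fixing_mapsTo_inf (P U : Submodule K V) :
    ∃ π : V →ₗ[K] V, (∀ p ∈ P, π p = p) ∧ ∀ u ∈ U, π u ∈ U ⊓ P := by
  obtain ⟨Q, hdisj, hsup⟩ := IsModularLattice.exists_disjoint_and_sup_eq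
    (inf_le_left : U ⊓ P ≤ U)
  have hQU : Q ≤ U := hsup ▸ le_sup_right
  have hQP : Disjoint Q P := by
    rw [Submodule.disjoint_def]
    intro x hxQ hxP
    exact Submodule.disjoint_def.1 hdisj x ⟨hQU hxQ, hxP⟩ hxQ
  obtain ⟨R, hQR, hR⟩ := hQP.exists_isCompl
  refine ⟨P.projection R hR.symm, fun p hp => ?_, fun u hu => ?_⟩
  · exact Submodule.projection_apply_left hR.symm ⟨p, hp⟩
  · rw [← hsup] at hu
    obtain ⟨p, hp, q, hq, rfl⟩ := Submodule.mem_sup.1 hu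
    have h1 : P.projection R hR.symm p = p :=
      Submodule.projection_apply_left hR.symm ⟨p, hp.2⟩
    have h2 : P.projection R hR.symm q = 0 :=
      Submodule.projection_apply_right hR.symm ⟨q, hQR hq⟩
    rw [map_add, h1, h2, add_zero]
    exact hp

/-- The set of states reachable after `k` steps along trajectories whose outputs at the times
`0, …, k - 1` vanish. -/
def silentImage (A : V →ₗ[K] V) (C : V →ₗ[K] Y) : ℕ → Submodule K V
  | 0 => ⊤
  | k + 1 => (silentImage A C k ⊓ LinearMap.ker C).map A

theorem silentImage_succ_le (A : V →ₗ[K] V) (C : V →ₗ[K] Y) (k : ℕ) :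
    silentImage A C (k + 1) ≤ silentImage A C k := by
  induction k with
  | zero => exact le_top
  | succ k ih => exact Submodule.map_mono (inf_le_inf_right _ ih)

theorem exists_of_mem_silentImage (A : V →ₗ[K] V) (C : V →ₗ[K] Y) (k : ℕ) :
    ∀ x ∈ silentImage A C k, ∃ v, x = (A ^ k) v ∧ ∀ i < k, C ((A ^ i) v) = 0 := by
  induction k with
  | zero => exact fun x _ => ⟨x, by simp, by simp⟩
  | succ k ih =>
    rintro _ ⟨w, ⟨hw, hwC⟩, rfl⟩
    obtain ⟨v, rfl, hv⟩ := ih w hw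
    refine ⟨v, by rw [pow_succ', Module.End.mul_apply], fun i hi => ?_⟩
    rcases Nat.lt_succ_iff_lt_or_eq.1 hi with h | rfl
    · exact hv i h
    · exact hwC

/-- The states whose first `k` outputs vanish. -/
def unobservable (A : V →ₗ[K] V) (C : V →ₗ[K] Y) (k : ℕ) : Submodule K V :=
  ⨅ i : Fin k, LinearMap.ker (C ∘ₗ A ^ (i : ℕ))

theorem mem_unobservable {A : V →ₗ[K] V} {C : V →ₗ[K] Y} {k : ℕ} {x : V} :
    x ∈ unobservable A C k ↔ ∀ i < k, C ((A ^ i) x) = 0 := by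
  simp [unobservable, Fin.forall_iff]

/-- The spaces `unobservable A C k` decrease with `k`, so they stabilise in finite dimension. -/
theorem exists_horizon_of_observable [FiniteDimensional K V] (A : V →ₗ[K] V) (C : V →ₗ[K] Y)
    (hobs : ∀ x, (∀ k, C ((A ^ k) x) = 0) → x = 0) :
    ∃ m, ∀ x, (∀ i < m, C ((A ^ i) x) = 0) → x = 0 := by
  let f : ℕ →o (Submodule K V)ᵒᵈ :=
    ⟨fun k => OrderDual.toDual (unobservable A C k), fun a b hab x hx => by
      have hx' : x ∈ unobservable A C b := hx
      exact mem_unobservable.2 fun i hi => mem_unobservable.1 hx' i (hi.trans_le hab)⟩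
  obtain ⟨m, hm⟩ := IsArtinian.monotone_stabilizes f
  refine ⟨m, fun x hx => hobs x fun k => ?_⟩
  have h : unobservable A C m = unobservable A C (m + k + 1) := hm (m + k + 1) (by omega)
  have hx' : x ∈ unobservable A C (m + k + 1) := h ▸ mem_unobservable.2 hx
  exact mem_unobservable.1 hx' k (by omega)

/-- The shift property holds trivially for `i ≥ m`, with `F = A`, and is extended downwards one
index at a time; `d` counts the indices gained. At `d = m` it holds for all `i`. -/
theorem exists_shift_silentImage (A : V →ₗ[K] V) (C : V →ₗ[K] Y) {m : ℕ}
    (hm : silentImage A C m = ⊥) (d : ℕ) :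
    ∃ F : V →ₗ[K] V, (∀ x, C x = 0 → F x = A x) ∧
      ∀ i, m ≤ i + d → ∀ x ∈ silentImage A C i, F x ∈ silentImage A C (i + 1) := by
  induction d with
  | zero =>
    refine ⟨A, fun _ _ => rfl, fun i hi x hx => ?_⟩
    have h : silentImage A C i ≤ silentImage A C m :=
      antitone_nat_of_succ_le (silentImage_succ_le A C) (by simpa using hi)
    have hx0 : x = 0 := by simpa [hm] using h hx
    simp [hx0]
  | succ d ih =>
    obtain ⟨F, hFC, hF⟩ := ih
    rcases le_or_gt m d with hmd | hmd
    · exact ⟨F, hFC, fun i _ => hF i (by omega)⟩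
    obtain ⟨e, rfl⟩ : ∃ e, m = e + d + 1 := ⟨m - d - 1, by omega⟩
    -- The new index is `e`. Precomposing with `π` changes nothing on `ker C` or on `silentImage A C
    -- (e + 1)`, where `F` is already right.
    obtain ⟨π, hπ, hπU⟩ := exists_linearMap_fixing_mapsTo_inf
      (silentImage A C (e + 1) ⊔ LinearMap.ker C) (silentImage A C e)
    refine ⟨F ∘ₗ π, fun x hx => ?_, fun i hi x hx => ?_⟩
    · rw [LinearMap.comp_apply, hπ x (Submodule.mem_sup_right hx), hFC x hx]
    rcases Nat.lt_or_ge e i with h | h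
    · have hx' : x ∈ silentImage A C (e + 1) :=
        antitone_nat_of_succ_le (silentImage_succ_le A C) h hx
      rw [LinearMap.comp_apply, hπ x (Submodule.mem_sup_left hx')]
      exact hF i (by omega) x hx
    · obtain rfl : i = e := by omega
      obtain ⟨hU, hP⟩ := hπU x hx
      rw [LinearMap.comp_apply]
      -- `π x = u + c`: the part `u` is handled by the old `F`, while `c` lies in `silentImage A C e
      -- ⊓ ker C`, where `F` acts as `A`.
      obtain ⟨u, hu, c, hc, huc⟩ := Submodule.mem_sup.1 hP
      rw [← huc] at hU ⊢
      rw [map_add, hFC c hc]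
      refine Submodule.add_mem _
        (silentImage_succ_le A C _ (hF (i + 1) (by omega) u hu)) ?_
      refine Submodule.mem_map_of_mem ⟨?_, hc⟩
      simpa using Submodule.sub_mem _ hU (silentImage_succ_le A C _ hu)

/-- A linear map vanishing on the kernel of `C` factors through `C`. -/
theorem exists_eq_comp_of_ker_le {W : Type*} [AddCommGroup W] [Module K W] (C : V →ₗ[K] Y)
    (B : V →ₗ[K] W) (h : ∀ x, C x = 0 → B x = 0) : ∃ L : Y →ₗ[K] W, L ∘ₗ C = B := by
  -- `g` extends a section of `C` over its range, so `g (C x)` and `x` differ by an element of the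
  -- kernel.
  obtain ⟨s, hs⟩ := C.rangeRestrict.exists_rightInverse_of_surjective C.range_rangeRestrict
  obtain ⟨g, hg⟩ := LinearMap.exists_extend s
  refine ⟨B ∘ₗ g, LinearMap.ext fun x => ?_⟩
  have h1 : g (C x) = s (C.rangeRestrict x) := congr($hg (C.rangeRestrict x))
  have h2 : C (s (C.rangeRestrict x)) = C x :=
    congrArg Subtype.val congr($hs (C.rangeRestrict x))
  have h3 : B (g (C x) - x) = 0 := h _ (by rw [map_sub, h1, h2, sub_self])
  rw [map_sub, sub_eq_zero] at h3
  exact h3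

/-- An observable pair admits a deadbeat output injection. -/
theorem exists_isNilpotent_sub_comp [FiniteDimensional K V] (A : V →ₗ[K] V) (C : V →ₗ[K] Y)
    (hobs : ∀ x, (∀ k, C ((A ^ k) x) = 0) → x = 0) :
    ∃ L : Y →ₗ[K] V, ∃ m, (A - L ∘ₗ C) ^ m = 0 := by
  obtain ⟨m, hm⟩ := exists_horizon_of_observable A C hobs
  have hbot : silentImage A C m = ⊥ := by
    refine (Submodule.eq_bot_iff _).2 fun x hx => ?_
    obtain ⟨v, rfl, hv⟩ := exists_of_mem_silentImage A C m x hx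
    rw [hm v hv, map_zero]
  obtain ⟨F, hFC, hF⟩ := exists_shift_silentImage A C hbot m
  obtain ⟨L, hL⟩ := exists_eq_comp_of_ker_le C (A - F) fun x hx => by
    rw [LinearMap.sub_apply, hFC x hx, sub_self]
  refine ⟨L, m, LinearMap.ext fun x => ?_⟩
  rw [hL, sub_sub_cancel]
  have key : ∀ k, (F ^ k) x ∈ silentImage A C k := by
    intro k
    induction k with
    | zero => exact Submodule.mem_top
    | succ k ih =>
      rw [pow_succ', Module.End.mul_apply]
      exact hF k (by omega) _ ih
  simpa [hbot] using key m

end Deadbeat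

theorem toLin'_pow_apply {ι : Type*} [Fintype ι] [DecidableEq ι] (A : Matrix ι ι ℝ) (k : ℕ)
    (x : ι → ℝ) : (Matrix.toLin' A ^ k) x = A ^ k *ᵥ x := by
  rw [← Matrix.toLin'_pow, Matrix.toLin'_apply]

/-- An observable matrix pair admits a deadbeat observer gain. -/
theorem Observable.exists_deadbeat {ι κ : Type*} [Fintype ι] [DecidableEq ι] [Fintype κ]
    [DecidableEq κ] {A : Matrix ι ι ℝ} {C : Matrix κ ι ℝ} (h : Observable A C) :
    ∃ L : Matrix ι κ ℝ, ∃ m, (A - L * C) ^ m = 0 := by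
  obtain ⟨L, m, hm⟩ := exists_isNilpotent_sub_comp (Matrix.toLin' A) (Matrix.toLin' C)
    fun x hx => h x 0 fun k => by simpa [toLin'_pow_apply] using hx k
  refine ⟨LinearMap.toMatrix' L, m, ?_⟩
  apply Matrix.toLin'.injective
  rw [Matrix.toLin'_pow, map_sub, Matrix.toLin'_mul, Matrix.toLin'_toMatrix', hm, map_zero]

/-! ### Propagation of freshness-indices -/

section Freshness

variable {N n : ℕ} {r : Fin N → ℕ} {A : Matrix (Fin n) (Fin n) ℝ}
  {C : (i : Fin N) → Matrix (Fin (r i)) (Fin n) ℝ} {D : ObsForm A C}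
  {L : (j : Fin N) → Matrix (Fin (D.dim j)) (Fin (r j)) ℝ}
  {G : ℕ → Digraph (Fin N)} {y : ℕ → (i : Fin N) → Fin (r i) → ℝ}
  {τ : ℕ → Fin N → Fin N → ℕ∞} {zh : ℕ → Fin N → (Σ q, Fin (D.dim q)) → ℝ}

/-- Every step of a non-source node copies the estimate of some node `u`, and the index of `u`
is at most that of the node itself and those of its neighbors. -/
theorem IsExecution.exists_copied (h : IsExecution D L G y τ zh) (k : ℕ) {i j : Fin N}
    (hij : i ≠ j) :
    ∃ u, τ (k + 1) i j = τ k u j + 1 ∧ τ k u j ≤ τ k i j ∧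
      (∀ l, (G k).Adj l i → τ k u j ≤ τ k l j) ∧
      substate (zh (k + 1) i) j = relayUpdate D j (zh k u) (zh k i) := by
  by_cases hτ : τ k i j = ⊤
  · rcases (setM (G k) (τ k) i j).eq_empty_or_nonempty with hM | hM
    · obtain ⟨h1, h2⟩ := h.case1_open k i j hij hτ hM
      refine ⟨i, by rw [h1, hτ]; rfl, le_rfl, fun l hl => ?_, h2⟩
      by_contra hlt
      have hlt' := not_le.1 hlt
      have : l ∈ setM (G k) (τ k) i j :=
        ⟨fun e => hlt (by rw [e]), hl, (lt_top_of_lt hlt').ne⟩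
      simp [hM] at this
    · obtain ⟨u, ⟨huS, hu⟩, h1, h2⟩ := h.case1_listen k i j hij hτ hM
      refine ⟨u, h1, by rw [hτ]; exact le_top, fun l hl => ?_, h2⟩
      by_contra hlt
      have hlt' := not_le.1 hlt
      refine hlt (hu l ⟨?_, hl, (lt_top_of_lt hlt').ne⟩)
      -- Self-loops are allowed in the graph but excluded from the neighbor set, so `l = i` is
      -- treated apart.
      rintro rfl
      rw [hτ] at hlt'
      exact not_top_lt hlt'
  · rcases (setF (G k) (τ k) i j).eq_empty_or_nonempty with hF | hF
    · obtain ⟨h1, h2⟩ := h.case2_open k i j hij hτ hF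
      refine ⟨i, h1, le_rfl, fun l hl => ?_, h2⟩
      by_contra hlt
      have hlt' := not_le.1 hlt
      have : l ∈ setF (G k) (τ k) i j :=
        ⟨⟨fun e => hlt (by rw [e]), hl, (lt_top_of_lt hlt').ne⟩, hlt'⟩
      simp [hF] at this
    · obtain ⟨u, ⟨huS, hu⟩, h1, h2⟩ := h.case2_listen k i j hij hτ hF
      refine ⟨u, h1, huS.2.le, fun l hl => ?_, h2⟩
      by_contra hlt
      have hlt' := not_le.1 hlt
      refine hlt (hu l ⟨⟨?_, hl, (lt_top_of_lt hlt').ne⟩, hlt'.trans huS.2⟩)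
      rintro rfl
      exact absurd huS.2 (not_lt.2 hlt'.le)

/-- The nodes which at time `s` hold information on substate `j` that left its source at time
`K` or later. -/
def freshSince (τ : ℕ → Fin N → Fin N → ℕ∞) (j : Fin N) (K s : ℕ) : Set (Fin N) :=
  {i | τ s i j + K ≤ s}

theorem IsExecution.source_mem_freshSince (h : IsExecution D L G y τ zh) (j : Fin N) {K s : ℕ}
    (hs : K ≤ s) : j ∈ freshSince τ j K s := by
  simpa [freshSince, h.source_index] using hs

/-- A copied index grows by one while the clock also advances by one, so the departure time is
unchanged; a node copies data at least as fresh as its own and its neighbors'. -/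
theorem IsExecution.freshSince_step (h : IsExecution D L G y τ zh) {j l i : Fin N} {K s : ℕ}
    (hl : l ∈ freshSince τ j K s) (hli : l = i ∨ (G s).Adj l i) :
    i ∈ freshSince τ j K (s + 1) := by
  have hl' : τ s l j + K ≤ s := hl
  have hKs : K ≤ s := by exact_mod_cast (le_add_self : (K : ℕ∞) ≤ τ s l j + K).trans hl'
  rcases eq_or_ne i j with rfl | hij
  · exact h.source_mem_freshSince _ (by omega)
  obtain ⟨u, h1, h2, h3, -⟩ := h.exists_copied s hij
  have hul : τ s u j ≤ τ s l j := by
    rcases hli with rfl | hli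
    exacts [h2, h3 l hli]
  change τ (s + 1) i j + K ≤ ((s + 1 : ℕ) : ℕ∞)
  calc τ (s + 1) i j + K = (τ s u j + K) + 1 := by rw [h1, add_right_comm]
    _ ≤ (τ s l j + K) + 1 := by gcongr
    _ ≤ s + 1 := by gcongr
    _ = ((s + 1 : ℕ) : ℕ∞) := by push_cast; rfl

theorem IsExecution.freshSince_mono (h : IsExecution D L G y τ zh) (j : Fin N) (K : ℕ) :
    Monotone (freshSince τ j K) :=
  monotone_nat_of_le_succ fun _ _ hl => h.freshSince_step hl (Or.inl rfl)

/-- A set containing `j` and closed under the edges of a strongly connected graph is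
everything. -/
theorem StronglyConnected.exists_adj_of_ne_univ {V : Type*} {H : Digraph V}
    (hH : StronglyConnected H) {S : Set V} {j : V} (hj : j ∈ S) (hS : S ≠ Set.univ) :
    ∃ u ∈ S, ∃ v ∉ S, H.Adj u v := by
  by_contra! hcon
  refine hS (Set.eq_univ_of_forall fun v => ?_)
  induction hH j v with
  | refl => exact hj
  | tail _ huv ih =>
    by_contra hv
    exact hcon _ ih _ hv huv

theorem IsExecution.exists_freshSince_eq_univ (h : IsExecution D L G y τ zh)
    (hG : JointlyStronglyConnected G) (j : Fin N) (K : ℕ) :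
    ∃ s₀, ∀ s, s₀ ≤ s → freshSince τ j K s = Set.univ := by
  obtain ⟨T, hT, hconn⟩ := hG
  have hmono := h.freshSince_mono j K
  have hKT : K ≤ K * T := Nat.le_mul_of_pos_right _ hT
  -- Over each window, strong connectivity gives an edge leaving the set, which therefore gains a
  -- node unless it is already everything. Starting at `K * T ≥ K` puts the source in it.
  have key : ∀ p, p ≤ (freshSince τ j K ((K + p) * T)).ncard ∨
      freshSince τ j K ((K + p) * T) = Set.univ := by
    intro p
    induction p with
    | zero => exact Or.inl (Nat.zero_le _)
    | succ p ih =>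
      have hle : freshSince τ j K ((K + p) * T) ⊆ freshSince τ j K ((K + (p + 1)) * T) :=
        hmono (Nat.mul_le_mul_right _ (by omega))
      rcases eq_or_ne (freshSince τ j K ((K + p) * T)) Set.univ with hu | hu
      · exact Or.inr (Set.eq_univ_of_univ_subset (hu ▸ hle))
      have hp := ih.resolve_right hu
      obtain ⟨u, huS, v, hvS, t, ht1, ht2, huv⟩ := (hconn (K + p)).exists_adj_of_ne_univ
        (h.source_mem_freshSince j (K := K) (s := (K + p) * T)
          (hKT.trans (Nat.mul_le_mul_right _ (by omega)))) hu
      have hv : v ∈ freshSince τ j K ((K + (p + 1)) * T) :=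
        hmono (show t + 1 ≤ (K + (p + 1)) * T by rw [← add_assoc]; omega)
          (h.freshSince_step (hmono ht1 huS) (Or.inr huv))
      left
      have hlt := Set.ncard_lt_ncard (ssubset_of_subset_not_subset hle fun hs => hvS (hs hv))
        (Set.toFinite _)
      omega
  -- With `N + 1` windows the cardinality alternative exceeds the number of nodes, leaving only the
  -- full set.
  refine ⟨(K + (N + 1)) * T, fun s hs => ?_⟩
  refine Set.eq_univ_of_univ_subset (le_trans ?_ (hmono hs))
  rcases key (N + 1) with hc | hc
  · have := Set.ncard_le_ncard (Set.subset_univ (freshSince τ j K ((K + (N + 1)) * T)))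
      (Set.toFinite _)
    rw [Set.ncard_univ, Nat.card_eq_fintype_card, Fintype.card_fin] at this
    omega
  · exact hc.ge

end Freshness

/-! ### Finite-time convergence of the estimates -/

theorem substate_mulVec {N : ℕ} {d : Fin N → ℕ} (M : Matrix (Σ j, Fin (d j)) (Σ j, Fin (d j)) ℝ)
    (z : (Σ j, Fin (d j)) → ℝ) (j : Fin N) :
    substate (M *ᵥ z) j = ∑ q, sqBlock M j q *ᵥ substate z q := by
  ext a
  simp [substate, sqBlock, Matrix.mulVec, dotProduct, Fintype.sum_sigma]

theorem mulVec_eq_sum_colBlock {N m : ℕ} {d : Fin N → ℕ} (M : Matrix (Fin m) (Σ j, Fin (d j)) ℝ)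
    (z : (Σ j, Fin (d j)) → ℝ) : M *ᵥ z = ∑ q, colBlock M q *ᵥ substate z q := by
  ext a
  simp [substate, colBlock, Matrix.mulVec, dotProduct, Fintype.sum_sigma]

theorem sum_eq_add_sum_Iio {N : ℕ} {M : Type*} [AddCommMonoid M] (j : Fin N) (f : Fin N → M)
    (hf : ∀ q, j < q → f q = 0) : ∑ q, f q = f j + ∑ q ∈ Finset.Iio j, f q := by
  rw [← Finset.sum_insert (by simp), Finset.Iio_insert]
  exact (Finset.sum_subset (Finset.subset_univ _) fun q _ hq => hf q (by simpa using hq)).symm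

section Convergence

variable {N n : ℕ} {r : Fin N → ℕ} {A : Matrix (Fin n) (Fin n) ℝ}
  {C : (i : Fin N) → Matrix (Fin (r i)) (Fin n) ℝ}

theorem ObsForm.substate_next (D : ObsForm A C) (x : Fin n → ℝ) (j : Fin N) :
    substate (D.Tinv *ᵥ (A *ᵥ x)) j = relayUpdate D j (D.Tinv *ᵥ x) (D.Tinv *ᵥ x) := by
  have h : D.Tinv *ᵥ (A *ᵥ x) = (D.Tinv * A * D.T) *ᵥ (D.Tinv *ᵥ x) := by
    rw [Matrix.mulVec_mulVec, Matrix.mulVec_mulVec, Matrix.mul_assoc (D.Tinv * A),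
      D.T_mul_Tinv, Matrix.mul_one]
  rw [h, substate_mulVec, sum_eq_add_sum_Iio j]
  · rfl
  · intro q hq
    rw [D.A_upper j q hq, Matrix.zero_mulVec]

theorem ObsForm.output_eq (D : ObsForm A C) (x : Fin n → ℝ) (j : Fin N) :
    C j *ᵥ x = D.Cb j j *ᵥ substate (D.Tinv *ᵥ x) j
      + ∑ q ∈ Finset.Iio j, D.Cb j q *ᵥ substate (D.Tinv *ᵥ x) q := by
  have h : C j *ᵥ x = (C j * D.T) *ᵥ (D.Tinv *ᵥ x) := by
    rw [Matrix.mulVec_mulVec, Matrix.mul_assoc, D.T_mul_Tinv, Matrix.mul_one]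
  rw [h, mulVec_eq_sum_colBlock, sum_eq_add_sum_Iio j]
  · rfl
  · intro q hq
    rw [D.C_upper j q hq, Matrix.zero_mulVec]

/-- With an exact measurement, the source update is a model step up to output injection. -/
theorem ObsForm.sourceUpdate_sub (D : ObsForm A C)
    (L : (j : Fin N) → Matrix (Fin (D.dim j)) (Fin (r j)) ℝ) (x : Fin n → ℝ)
    (z : (Σ q, Fin (D.dim q)) → ℝ) (j : Fin N)
    (hz : ∀ q < j, substate z q = substate (D.Tinv *ᵥ x) q) :
    sourceUpdate D L j z (C j *ᵥ x) - substate (D.Tinv *ᵥ (A *ᵥ x)) j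
      = (D.Ab j j - L j * D.Cb j j) *ᵥ (substate z j - substate (D.Tinv *ᵥ x) j) := by
  rw [D.substate_next, D.output_eq x j, sourceUpdate, relayUpdate]
  have h : ∑ q ∈ Finset.Iio j, (D.Ab j q - L j * D.Cb j q) *ᵥ substate z q
      = ∑ q ∈ Finset.Iio j, D.Ab j q *ᵥ substate (D.Tinv *ᵥ x) q
        - L j *ᵥ ∑ q ∈ Finset.Iio j, D.Cb j q *ᵥ substate (D.Tinv *ᵥ x) q := by
    rw [Matrix.mulVec_sum, ← Finset.sum_sub_distrib]
    refine Finset.sum_congr rfl fun q hq => ?_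
    rw [hz q (Finset.mem_Iio.1 hq), Matrix.sub_mulVec, Matrix.mulVec_mulVec]
  rw [h, Matrix.mulVec_sub, Matrix.sub_mulVec _ _ (substate (D.Tinv *ᵥ x) j),
    Matrix.mulVec_add, Matrix.mulVec_mulVec]
  abel

variable {D : ObsForm A C} {L : (j : Fin N) → Matrix (Fin (D.dim j)) (Fin (r j)) ℝ}
  {G : ℕ → Digraph (Fin N)} {x : ℕ → Fin n → ℝ}
  {τ : ℕ → Fin N → Fin N → ℕ∞} {zh : ℕ → Fin N → (Σ q, Fin (D.dim q)) → ℝ}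

/-- With a deadbeat gain, the source reaches its own substate once the lower ones are exact. -/
theorem IsExecution.source_eventually_exact
    (h : IsExecution D L G (fun k i => C i *ᵥ x k) τ zh) (hx : ∀ k, x (k + 1) = A *ᵥ x k)
    {j : Fin N} {m : ℕ} (hL : (D.Ab j j - L j * D.Cb j j) ^ m = 0) {K : ℕ}
    (hK : ∀ k, K ≤ k → ∀ q < j, substate (zh k j) q = substate (D.Tinv *ᵥ x k) q) :
    ∀ k, K + m ≤ k → substate (zh k j) j = substate (D.Tinv *ᵥ x k) j := by
  have key : ∀ s, substate (zh (K + s) j) j - substate (D.Tinv *ᵥ x (K + s)) j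
      = (D.Ab j j - L j * D.Cb j j) ^ s
        *ᵥ (substate (zh K j) j - substate (D.Tinv *ᵥ x K) j) := by
    intro s
    induction s with
    | zero => simp
    | succ s ih =>
      rw [← add_assoc, h.source_estimate, hx,
        D.sourceUpdate_sub L _ _ j (hK (K + s) (by omega)), ih, Matrix.mulVec_mulVec, ← pow_succ']
  intro k hk
  obtain ⟨s, rfl⟩ := Nat.exists_eq_add_of_le hk
  have := key (m + s)
  rw [pow_add, hL, Matrix.zero_mul, Matrix.zero_mulVec, sub_eq_zero, ← add_assoc] at this
  exact this

/-- Information that left the source after it became exact is exact at every node. -/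
theorem IsExecution.exact_of_mem_freshSince
    (h : IsExecution D L G (fun k i => C i *ᵥ x k) τ zh) (hx : ∀ k, x (k + 1) = A *ᵥ x k)
    {j : Fin N} {K : ℕ}
    (hK : ∀ k, K ≤ k → ∀ i, ∀ q < j, substate (zh k i) q = substate (D.Tinv *ᵥ x k) q)
    (hsrc : ∀ k, K ≤ k → substate (zh k j) j = substate (D.Tinv *ᵥ x k) j) :
    ∀ k i, i ∈ freshSince τ j K k → substate (zh k i) j = substate (D.Tinv *ᵥ x k) j := by
  intro k
  induction k with
  | zero =>
    intro i hi
    rcases eq_or_ne i j with rfl | hij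
    · refine hsrc 0 ?_
      have hi' : τ 0 i i + K ≤ (0 : ℕ) := hi
      exact_mod_cast (le_add_self : (K : ℕ∞) ≤ τ 0 i i + K).trans hi'
    · have hi' : τ 0 i j + K ≤ (0 : ℕ) := hi
      -- An infinite initial index keeps arbitrary initial guesses from counting as fresh.
      rw [h.init_index i j hij] at hi'
      simp at hi'
  | succ k ih =>
    intro i hi
    have hi' : τ (k + 1) i j + K ≤ ((k + 1 : ℕ) : ℕ∞) := hi
    rcases eq_or_ne i j with rfl | hij
    · exact hsrc _ (by exact_mod_cast (le_add_self : (K : ℕ∞) ≤ τ (k + 1) i i + K).trans hi')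
    obtain ⟨u, h1, -, -, h4⟩ := h.exists_copied k hij
    have hu : τ k u j + K ≤ k := by
      rw [h1, add_right_comm] at hi'
      push_cast at hi'
      exact (ENat.add_le_add_iff_right ENat.one_ne_top).1 hi'
    have hKk : K ≤ k := by exact_mod_cast (le_add_self : (K : ℕ∞) ≤ τ k u j + K).trans hu
    rw [h4, hx, D.substate_next, relayUpdate, relayUpdate, ih u hu]
    congr 1
    exact Finset.sum_congr rfl fun q hq => by rw [hK k hKk i q (Finset.mem_Iio.1 hq)]

/-- With deadbeat gains every node knows each substate exactly after finitely many steps. -/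
theorem IsExecution.substate_eventually_exact
    (h : IsExecution D L G (fun k i => C i *ᵥ x k) τ zh) (hx : ∀ k, x (k + 1) = A *ᵥ x k)
    (hG : JointlyStronglyConnected G)
    (hL : ∀ j, ∃ m, (D.Ab j j - L j * D.Cb j j) ^ m = 0) (j : Fin N) :
    ∃ K, ∀ k, K ≤ k → ∀ i, substate (zh k i) j = substate (D.Tinv *ᵥ x k) j := by
  induction j using WellFoundedLT.induction with
  | ind j ih =>
    choose! K hK using ih
    obtain ⟨m, hm⟩ := hL j
    have hlow : ∀ k, (Finset.Iio j).sup K ≤ k → ∀ i, ∀ q < j,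
        substate (zh k i) q = substate (D.Tinv *ᵥ x k) q := fun k hk i q hq =>
      hK q hq k ((Finset.le_sup (Finset.mem_Iio.2 hq)).trans hk) i
    have hsrc := h.source_eventually_exact hx hm fun k hk => hlow k hk j
    -- The source is exact from `sup K + m` on: the lower substates settle first, then the nilpotent
    -- error needs `m` steps.
    obtain ⟨s₀, hs₀⟩ := h.exists_freshSince_eq_univ hG j ((Finset.Iio j).sup K + m)
    refine ⟨s₀, fun k hk i => ?_⟩
    refine h.exact_of_mem_freshSince hx (fun k hk => hlow k (by omega)) hsrc k i ?_
    rw [hs₀ k hk]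
    exact Set.mem_univ i

theorem IsExecution.eventually_exact
    (h : IsExecution D L G (fun k i => C i *ᵥ x k) τ zh) (hx : ∀ k, x (k + 1) = A *ᵥ x k)
    (hG : JointlyStronglyConnected G)
    (hL : ∀ j, ∃ m, (D.Ab j j - L j * D.Cb j j) ^ m = 0) :
    ∃ K, ∀ k, K ≤ k → ∀ i, zh k i = D.Tinv *ᵥ x k := by
  choose K hK using h.substate_eventually_exact hx hG hL
  refine ⟨Finset.univ.sup K, fun k hk i => funext fun ⟨j, a⟩ => ?_⟩
  exact congrFun (hK j k ((Finset.le_sup (Finset.mem_univ j)).trans hk) i) a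

end Convergence

/-- A finite family of nonnegative sequences that vanish from some time on decays at every
positive rate. -/
theorem exists_le_mul_pow_of_eventually_zero {ι : Type*} [Fintype ι] {f : ℕ → ι → ℝ} {ρ : ℝ}
    (hρ : 0 < ρ) (hf : ∀ k i, 0 ≤ f k i) {K : ℕ} (hK : ∀ k, K ≤ k → ∀ i, f k i = 0) :
    ∃ c, 0 ≤ c ∧ ∀ k i, f k i ≤ c * ρ ^ k := by
  have hterm : ∀ k i, 0 ≤ f k i / ρ ^ k := fun k i => div_nonneg (hf k i) (by positivity)
  refine ⟨∑ k ∈ Finset.range K, ∑ i, f k i / ρ ^ k,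
    Finset.sum_nonneg fun k _ => Finset.sum_nonneg fun i _ => hterm k i, fun k i => ?_⟩
  rcases lt_or_ge k K with hk | hk
  · rw [← div_le_iff₀ (by positivity)]
    refine (Finset.single_le_sum (fun i _ => hterm k i) (Finset.mem_univ i)).trans ?_
    exact Finset.single_le_sum (f := fun k => ∑ i, f k i / ρ ^ k)
      (fun k _ => Finset.sum_nonneg fun i _ => hterm k i) (Finset.mem_range.2 hk)
  · rw [hK k hk i]
    exact mul_nonneg (Finset.sum_nonneg fun k _ => Finset.sum_nonneg fun i _ => hterm k i)
      (by positivity)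

/-! ### The multi-sensor observable form -/

/-- A decreasing chain of subspaces from the whole space to zero has an adapted basis. -/
theorem exists_basis_adapted {K V : Type*} [Field K] [AddCommGroup V] [Module K V]
    [FiniteDimensional K V] {N : ℕ} {F : ℕ → Submodule K V} (hF : Antitone F) (h0 : F 0 = ⊤)
    (hN : F N = ⊥) :
    ∃ (d : Fin N → ℕ) (b : Module.Basis (Σ j, Fin (d j)) K V),
      (∀ p, b p ∈ F p.1) ∧
        ∀ m, ∀ x ∈ F m, ∀ p : Σ j, Fin (d j), (p.1 : ℕ) < m → b.repr x p = 0 := by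
  -- `W m` complements `F (m + 1)` in `F m`; block `j` of the basis is a basis of `W j`.
  choose W hW hsup using fun m : ℕ =>
    IsModularLattice.exists_disjoint_and_sup_eq (hF (Nat.le_succ m))
  let v : (Σ j : Fin N, Fin (Module.finrank K (W j))) → V :=
    fun p => (Module.finBasis K (W p.1) p.2 : V)
  have hvW : ∀ p, v p ∈ W p.1 := fun p => Subtype.prop _
  have hWF : ∀ m, W m ≤ F m := fun m => (hsup m) ▸ le_sup_right
  have hv : ∀ p, v p ∈ F p.1 := fun p => hWF _ (hvW p)
  have hli : LinearIndependent K v := by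
    rw [Fintype.linearIndependent_iff]
    intro g hg
    suffices ∀ j : Fin N, ∀ a, g ⟨j, a⟩ = 0 from fun p => this p.1 p.2
    intro j
    induction j using WellFoundedLT.induction with
    | ind j ih =>
      -- Blocks below `j` vanish by induction and those above lie in `F (j + 1)`, so the block `j`
      -- sum lies in `W j ⊓ F (j + 1) = ⊥`.
      rw [Fintype.sum_sigma, ← Finset.add_sum_erase _ _ (Finset.mem_univ j)] at hg
      have hmemW : ∑ a, g ⟨j, a⟩ • v ⟨j, a⟩ ∈ W j :=
        Submodule.sum_mem _ fun a _ => Submodule.smul_mem _ _ (hvW ⟨j, a⟩)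
      have hmemF : ∑ a, g ⟨j, a⟩ • v ⟨j, a⟩ ∈ F (j + 1) := by
        rw [eq_neg_of_add_eq_zero_left hg]
        refine Submodule.neg_mem _ (Submodule.sum_mem _ fun q hq => ?_)
        refine Submodule.sum_mem _ fun a _ => ?_
        rcases lt_or_gt_of_ne (Finset.ne_of_mem_erase hq) with hlt | hgt
        · rw [ih q hlt a, zero_smul]
          exact Submodule.zero_mem _
        · exact Submodule.smul_mem _ _ (hF (show (j : ℕ) + 1 ≤ q from hgt) (hv ⟨q, a⟩))
      have hzero := Submodule.disjoint_def.1 (hW j) _ hmemF hmemW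
      refine Fintype.linearIndependent_iff.1 (Module.finBasis K (W j)).linearIndependent
        (fun a => g ⟨j, a⟩) (Subtype.ext ?_)
      simpa [v] using hzero
  have hspan : ∀ e m, m + e = N → F m ≤ Submodule.span K (v '' {p | m ≤ (p.1 : ℕ)}) := by
    intro e
    induction e with
    | zero =>
      intro m hm
      rw [show m = N from hm, hN]
      exact bot_le
    | succ e ih =>
      intro m hm
      rw [← hsup m]
      refine sup_le ((ih (m + 1) (by omega)).trans (Submodule.span_mono
        (Set.image_mono fun p (hp : m + 1 ≤ (p.1 : ℕ)) => show m ≤ (p.1 : ℕ) by omega)))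
        fun w hw => ?_
      have hrep := congrArg Subtype.val ((Module.finBasis K (W m)).sum_repr ⟨w, hw⟩)
      rw [← show _ = w from hrep, Submodule.coe_sum]
      refine Submodule.sum_mem _ fun a _ => Submodule.smul_mem _ _ (Submodule.subset_span ?_)
      exact ⟨⟨⟨m, by omega⟩, a⟩, le_refl m, rfl⟩
  let b := Module.Basis.mk hli (by
    rw [← h0]
    exact (hspan N 0 (by omega)).trans (Submodule.span_mono (Set.image_subset_range _ _)))
  have hb : ∀ p, b p = v p := fun p => Module.Basis.mk_apply _ _ p
  refine ⟨_, b, fun p => hb p ▸ hv p, fun m x hx p hp => ?_⟩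
  rcases le_or_gt m N with hmN | hmN
  · have hx' := hspan (N - m) m (by omega) hx
    rw [← funext hb, Module.Basis.mem_span_image] at hx'
    by_contra hne
    exact absurd hp (not_lt.2 (hx' (Finsupp.mem_support_iff.2 hne)))
  · have hx0 : x = 0 := by simpa [hN] using hF hmN.le hx
    simp [hx0]

section

variable {N n : ℕ} {r : Fin N → ℕ}

/-- The states which are not observable from the first `m` sensors. -/
def jointlyUnobservable (A : Matrix (Fin n) (Fin n) ℝ)
    (C : (i : Fin N) → Matrix (Fin (r i)) (Fin n) ℝ) (m : ℕ) : Submodule ℝ (Fin n → ℝ) where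
  carrier := {x | ∀ i : Fin N, (i : ℕ) < m → ∀ k, C i *ᵥ (A ^ k *ᵥ x) = 0}
  zero_mem' := by simp
  add_mem' {x y} hx hy i hi k := by
    rw [Matrix.mulVec_add, Matrix.mulVec_add, hx i hi k, hy i hi k, add_zero]
  smul_mem' c x hx i hi k := by
    rw [Matrix.mulVec_smul, Matrix.mulVec_smul, hx i hi k, smul_zero]

theorem mem_jointlyUnobservable {A : Matrix (Fin n) (Fin n) ℝ}
    {C : (i : Fin N) → Matrix (Fin (r i)) (Fin n) ℝ} {m : ℕ} {x : Fin n → ℝ} :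
    x ∈ jointlyUnobservable A C m ↔ ∀ i : Fin N, (i : ℕ) < m → ∀ k, C i *ᵥ (A ^ k *ᵥ x) = 0 :=
  Iff.rfl

theorem mulVec_mem_jointlyUnobservable {A : Matrix (Fin n) (Fin n) ℝ}
    {C : (i : Fin N) → Matrix (Fin (r i)) (Fin n) ℝ} {m : ℕ} {x : Fin n → ℝ}
    (hx : x ∈ jointlyUnobservable A C m) : A *ᵥ x ∈ jointlyUnobservable A C m := by
  intro i hi k
  rw [Matrix.mulVec_mulVec x, ← pow_succ]
  exact hx i hi (k + 1)

theorem stack_mulVec_apply (C : (i : Fin N) → Matrix (Fin (r i)) (Fin n) ℝ) (x : Fin n → ℝ)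
    (i : Fin N) (a : Fin (r i)) : (stack C *ᵥ x) ⟨i, a⟩ = (C i *ᵥ x) a := rfl

/-- The multi-sensor observable form of a collectively observable system. -/
theorem nonempty_obsForm (A : Matrix (Fin n) (Fin n) ℝ)
    (C : (i : Fin N) → Matrix (Fin (r i)) (Fin n) ℝ) (hobs : Observable A (stack C)) :
    Nonempty (ObsForm A C) := by
  have hanti : Antitone (jointlyUnobservable A C) :=
    fun a b hab x hx i hi k => hx i (hi.trans_le hab) k
  have h0 : jointlyUnobservable A C 0 = ⊤ :=
    (Submodule.eq_top_iff').2 fun x i hi => absurd hi (Nat.not_lt_zero _)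
  have hN : jointlyUnobservable A C N = ⊥ := by
    refine (Submodule.eq_bot_iff _).2 fun x hx => hobs x 0 fun k => ?_
    ext ⟨i, a⟩
    rw [stack_mulVec_apply, stack_mulVec_apply, hx i i.2 k]
    simp
  obtain ⟨d, b, hb, hrepr⟩ := exists_basis_adapted hanti h0 hN
  let T : Matrix (Fin n) (Σ j, Fin (d j)) ℝ := Matrix.of fun s p => b p s
  let S : Matrix (Σ j, Fin (d j)) (Fin n) ℝ :=
    LinearMap.toMatrix' (b.equivFun : (Fin n → ℝ) →ₗ[ℝ] _)
  have hT : ∀ z, T *ᵥ z = b.equivFun.symm z := fun z => by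
    ext s
    simp [T, Matrix.mulVec, dotProduct, Module.Basis.equivFun_symm_apply, mul_comm]
  have hS : ∀ x, S *ᵥ x = b.equivFun x := fun x => by
    rw [← Matrix.toLin'_apply, Matrix.toLin'_toMatrix']
    rfl
  have hTS : T * S = 1 := Matrix.ext_of_mulVec_single fun i => by
    rw [← Matrix.mulVec_mulVec, hS, hT, LinearEquiv.symm_apply_apply, Matrix.one_mulVec]
  have hST : S * T = 1 := Matrix.ext_of_mulVec_single fun i => by
    rw [← Matrix.mulVec_mulVec, hT, hS, LinearEquiv.apply_symm_apply, Matrix.one_mulVec]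
  have hTcol : ∀ p, T *ᵥ Pi.single p 1 = b p := fun p => by
    ext s
    simp [T]
  have hSzero : ∀ m, ∀ x ∈ jointlyUnobservable A C m, ∀ q : Fin N, (q : ℕ) < m →
      substate (S *ᵥ x) q = 0 := fun m x hx q hq => by
    ext a
    rw [substate, hS]
    exact hrepr m x hx ⟨q, a⟩ hq
  have hA : ∀ j q : Fin N, j < q → sqBlock (S * A * T) j q = 0 := by
    intro j q hjq
    ext a c
    have h1 := congrFun (hSzero q _ (mulVec_mem_jointlyUnobservable (hb ⟨q, c⟩)) j hjq) a
    rw [← hTcol, Matrix.mulVec_mulVec, Matrix.mulVec_mulVec] at h1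
    simpa [substate, sqBlock] using h1
  have hC : ∀ j q : Fin N, j < q → colBlock (C j * T) q = 0 := by
    intro j q hjq
    ext a c
    have h1 := congrFun (hb ⟨q, c⟩ j hjq 0) a
    rw [← hTcol, pow_zero, Matrix.one_mulVec, Matrix.mulVec_mulVec] at h1
    simpa [colBlock] using h1
  refine ⟨⟨d, T, S, hTS, hST, hA, hC, fun j w w' hww => ?_⟩⟩
  rw [← sub_eq_zero]
  have hdiff : ∀ k, colBlock (C j * T) j *ᵥ (sqBlock (S * A * T) j j ^ k *ᵥ (w - w')) = 0 :=
    fun k => by rw [Matrix.mulVec_sub, Matrix.mulVec_sub, hww, sub_self]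
  -- For diagonal observability, `w - w'` is lifted to a state `x` that the sensors before `j`
  -- cannot see. If sensor `j` cannot see it either, its block `j` coordinates vanish.
  let x : Fin n → ℝ := ∑ a, (w - w') a • b ⟨j, a⟩
  have hxmem : x ∈ jointlyUnobservable A C j :=
    Submodule.sum_mem _ fun a _ => Submodule.smul_mem _ _ (hb ⟨j, a⟩)
  have hxj : substate (S *ᵥ x) j = w - w' := by
    ext a
    rw [substate, hS]
    simp [x, Finsupp.single_apply, Module.Basis.equivFun_apply]
  have hmem : ∀ k, A ^ k *ᵥ x ∈ jointlyUnobservable A C j := by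
    intro k
    induction k with
    | zero => simpa using hxmem
    | succ k ih =>
      rw [pow_succ', ← Matrix.mulVec_mulVec]
      exact mulVec_mem_jointlyUnobservable ih
  -- Along the orbit of `x` the coordinates below `j` are zero, and blocks above the diagonal
  -- vanish, so substate `j` evolves by the diagonal block alone.
  have hsub : ∀ k, substate (S *ᵥ (A ^ k *ᵥ x)) j = sqBlock (S * A * T) j j ^ k *ᵥ (w - w') := by
    intro k
    induction k with
    | zero => simpa using hxj
    | succ k ih =>
      have hstep : S *ᵥ (A ^ (k + 1) *ᵥ x) = (S * A * T) *ᵥ (S *ᵥ (A ^ k *ᵥ x)) := by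
        rw [pow_succ', Matrix.mulVec_mulVec, Matrix.mulVec_mulVec, Matrix.mulVec_mulVec,
          Matrix.mul_assoc (S * A), hTS, Matrix.mul_one, Matrix.mul_assoc]
      rw [hstep, substate_mulVec, sum_eq_add_sum_Iio j, ih, Finset.sum_eq_zero, add_zero,
        Matrix.mulVec_mulVec, ← pow_succ']
      · intro q hq
        rw [hSzero j _ (hmem k) q (Fin.lt_def.1 (Finset.mem_Iio.1 hq)), Matrix.mulVec_zero]
      · intro q hq
        rw [hA j q hq, Matrix.zero_mulVec]
  have hout : ∀ k, C j *ᵥ (A ^ k *ᵥ x) = 0 := by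
    intro k
    have h1 : C j *ᵥ (A ^ k *ᵥ x) = (C j * T) *ᵥ (S *ᵥ (A ^ k *ᵥ x)) := by
      rw [Matrix.mulVec_mulVec _ (C j * T), Matrix.mul_assoc, hTS, Matrix.mul_one]
    rw [h1, mulVec_eq_sum_colBlock, sum_eq_add_sum_Iio j, hsub, hdiff, zero_add]
    · refine Finset.sum_eq_zero fun q hq => ?_
      rw [hSzero j _ (hmem k) q (Fin.lt_def.1 (Finset.mem_Iio.1 hq)), Matrix.mulVec_zero]
    · intro q hq
      rw [hC j q hq, Matrix.zero_mulVec]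
  have hx1 : x ∈ jointlyUnobservable A C (j + 1) := by
    intro i hi k
    rcases Nat.lt_succ_iff_lt_or_eq.1 hi with hlt | heq
    · exact hxmem i hlt k
    · obtain rfl : i = j := Fin.ext heq
      exact hout k
  rw [← hxj, hSzero _ x hx1 j (Nat.lt_succ_self _)]

end

end DistObs

end


theorem theorem1 {N n : ℕ} {r : Fin N → ℕ} (A : Matrix (Fin n) (Fin n) ℝ)
    (C : (i : Fin N) → Matrix (Fin (r i)) (Fin n) ℝ)
    (hobs : DistObs.Observable A (DistObs.stack C)) :
    -- the coordinates in which the observer is run exist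
    Nonempty (DistObs.ObsForm A C) ∧
    -- and, in any such coordinates, gains can be designed for any desired rate
    ∀ (D : DistObs.ObsForm A C) (ρ : ℝ), 0 < ρ → ρ < 1 →
      ∃ L : (j : Fin N) → Matrix (Fin (D.dim j)) (Fin (r j)) ℝ,
        ∀ G : ℕ → Digraph (Fin N), DistObs.JointlyStronglyConnected G →
        ∀ x : ℕ → Fin n → ℝ, (∀ k, x (k + 1) = A *ᵥ x k) →
        ∀ (τ : ℕ → Fin N → Fin N → ℕ∞) (zh : ℕ → Fin N → (Σ q, Fin (D.dim q)) → ℝ),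
          DistObs.IsExecution D L G (fun k i => C i *ᵥ x k) τ zh →
          ∃ c : ℝ, ∀ (k : ℕ) (i : Fin N),
            DistObs.enorm2 (zh k i - D.Tinv *ᵥ x k) ≤ c * ρ ^ k ∧
            DistObs.enorm2 (D.T *ᵥ zh k i - x k) ≤ c * ρ ^ k := by
  refine ⟨DistObs.nonempty_obsForm A C hobs, fun D ρ hρ _ => ?_⟩
  choose L hL using fun j => (D.diag_observable j).exists_deadbeat
  refine ⟨L, fun G hG x hx τ zh h => ?_⟩
  -- `K`, and with it the constant, depends on the execution; the gains do not depend on `ρ`.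
  obtain ⟨K, hK⟩ := h.eventually_exact hx hG hL
  obtain ⟨c₁, hc₁, h₁⟩ := DistObs.exists_le_mul_pow_of_eventually_zero
    (f := fun k i => DistObs.enorm2 (zh k i - D.Tinv *ᵥ x k)) hρ (fun _ _ => norm_nonneg _)
    (K := K) fun k hk i => by simp [DistObs.enorm2, hK k hk i]
  obtain ⟨c₂, hc₂, h₂⟩ := DistObs.exists_le_mul_pow_of_eventually_zero
    (f := fun k i => DistObs.enorm2 (D.T *ᵥ zh k i - x k)) hρ (fun _ _ => norm_nonneg _)
    (K := K) fun k hk i => by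
      simp [DistObs.enorm2, hK k hk i, Matrix.mulVec_mulVec, D.T_mul_Tinv]
  refine ⟨c₁ + c₂, fun k i => ⟨(h₁ k i).trans ?_, (h₂ k i).trans ?_⟩⟩ <;> gcongr <;> linarith
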